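/- Let $m\ge 1$ and let $u_1,\ldots,u_m$ be independent real random variables having densities $\varphi_1,\ldots,\varphi_m$ with respect to Lebesgue measure. Let $A,B$ be constants such that for all $i$ $$\|\varphi_i\|_\infty\le A,\qquad \int_{\mathbb R}|t|\,\varphi_i(t)\,dt\le B .$$ (a) Let $x_0\le x_1$ be real numbers, let $w_2,\ldots,w_m\colon[x_0,x_1]\to\mathbb R$ be real analytic, and put $F(x):=u_1+\sum_{i=2}^m w_i(x)u_i$. If all functions $w_i$ are monotonically increasing (not necessarily strictly), then $$\mathbb E\,\#\{x\in[x_0,x_1] : F(x)=0\}\ \le\ AB\sum_{i=2}^m\bigl(w_i(x_1)-w_i(x_0)\bigr).$$ (b) In particular, for all integers $0=d_1<d_2<\cdots<d_m$, the random fewnomial $F(x)=\sum_{i=1}^m u_i x^{d_i}$ satisfies $$\mathbb E\,\#\{x\in[0,1] : F(x)=0\}\ \le\ AB\,(m-1).$$ Here zeros are counted without multiplicity, and the number of zeros is an almost everywhere measurable function with values in $\{0,1,2,\ldots,\infty\}$. -/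

import Mathlib

open MeasureTheory ProbabilityTheory Set
open scoped ENNReal

/-- The real random variable `X` on `(Ω, P)` has the density `φ` with respect to
Lebesgue measure: `φ ≥ 0` and `P (X ∈ S) = ∫_S φ` for all Borel sets `S`. -/
structure HasRealDensity {Ω : Type*} [MeasurableSpace Ω] (P : Measure Ω)
    (X : Ω → ℝ) (φ : ℝ → ℝ) : Prop where
  aemeasurable : AEMeasurable X P
  aemeasurable_density : AEMeasurable φ volume
  nonneg : ∀ t, 0 ≤ φ t
  map_eq : P.map X = volume.withDensity (fun t => ENNReal.ofReal (φ t))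

/-- The number of zeros of `f` in `[x₀, x₁]`, counted without multiplicity; it is `∞` if there
are infinitely many. -/
noncomputable def zeroCount (f : ℝ → ℝ) (x₀ x₁ : ℝ) : ℝ≥0∞ :=
  (({x ∈ Icc x₀ x₁ | f x = 0}.encard : ℕ∞) : ℝ≥0∞)

/-! Cut the line into cells of mesh `1 / (k + 1)`. As `k → ∞`, the number of cells containing a zero
tends to the number of zeros, so by Fatou it suffices to bound the sum over cells of P(a zero in the
cell), uniformly in `k`. Fix the coefficients `c` other than `u 0`. A zero in `(a, b]` forces `u 0`
into a set of diameter at most `∑ (w i b - w i a) |c i|`, so its conditional probability is at most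
`A` times this. Averaging over `c` replaces `|c i|` by `B`, and the increments of `w i` over all
cells add up to at most its total increase. -/

open Filter Topology

/-- The index `j` of the cell `((j - 1) / (k + 1), j / (k + 1)]` containing `x`. -/
noncomputable def cellIndex (k : ℕ) (x : ℝ) : ℤ := ⌈((k : ℝ) + 1) * x⌉

lemma cellIndex_eq_iff (k : ℕ) (x : ℝ) (j : ℤ) :
    cellIndex k x = j ↔ x ∈ Ioc (((j : ℝ) - 1) / (k + 1)) ((j : ℝ) / (k + 1)) := by
  have hk : (0 : ℝ) < (k : ℝ) + 1 := by positivity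
  rw [cellIndex, Int.ceil_eq_iff, mem_Ioc, div_lt_iff₀ hk, le_div_iff₀ hk, mul_comm x]

lemma eventually_cellIndex_ne {x y : ℝ} (h : x ≠ y) :
    ∀ᶠ k : ℕ in atTop, cellIndex k x ≠ cellIndex k y := by
  have h0 : 0 < |x - y| := abs_pos.2 (sub_ne_zero.2 h)
  obtain ⟨N, hN⟩ := exists_nat_gt (1 / |x - y|)
  filter_upwards [eventually_ge_atTop N] with k hk heq
  rw [div_lt_iff₀ h0] at hN
  have hk' : (N : ℝ) ≤ k := by exact_mod_cast hk
  have hpos : (0 : ℝ) < (k : ℝ) + 1 := by positivity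
  -- Numbers with equal ceilings differ by less than 1.
  have hlt : |((k : ℝ) + 1) * x - ((k : ℝ) + 1) * y| < 1 := by
    have hx := Int.ceil_eq_iff.1 (rfl : cellIndex k x = cellIndex k x)
    have hy := Int.ceil_eq_iff.1 (rfl : cellIndex k y = cellIndex k y)
    rw [heq] at hx
    rw [abs_lt]
    constructor <;> linarith [hx.1, hx.2, hy.1, hy.2]
  rw [← mul_sub, abs_mul, abs_of_pos hpos] at hlt
  nlinarith

lemma eventually_injOn_cellIndex {T : Set ℝ} (hT : T.Finite) :
    ∀ᶠ k : ℕ in atTop, InjOn (cellIndex k) T := by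
  have : ∀ᶠ k : ℕ in atTop, ∀ x ∈ T, ∀ y ∈ T, x ≠ y → cellIndex k x ≠ cellIndex k y := by
    refine (eventually_all_finite hT).2 fun x _ => (eventually_all_finite hT).2 fun y _ => ?_
    by_cases h : x = y
    · simp [h]
    · exact (eventually_cellIndex_ne h).mono fun k hk _ => hk
  filter_upwards [this] with k hk x hx y hy hxy
  by_contra h
  exact hk x hx y hy h hxy

/-- Any `n` points of `S` eventually lie in distinct cells, and the image never has more elements
than `S`. This includes infinite `S`. -/
lemma tendsto_encard_cellIndex_image (S : Set ℝ) :
    Tendsto (fun k : ℕ => (((cellIndex k '' S).encard : ℕ∞) : ℝ≥0∞)) atTop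
      (𝓝 ((S.encard : ℕ∞) : ℝ≥0∞)) := by
  have key : ∀ n : ℕ, (n : ℕ∞) ≤ S.encard →
      ∀ᶠ k : ℕ in atTop, (n : ℝ≥0∞) ≤ ((cellIndex k '' S).encard : ℕ∞) := by
    intro n hn
    obtain ⟨T, hTS, hT⟩ := exists_subset_encard_eq hn
    have hfin : T.Finite := finite_of_encard_eq_coe hT
    filter_upwards [eventually_injOn_cellIndex hfin] with k hk
    have h1 : (n : ℕ∞) ≤ (cellIndex k '' S).encard := by
      rw [← hT, ← hk.encard_image]
      exact encard_le_encard (image_mono hTS)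
    rw [← ENat.toENNReal_coe]
    exact ENat.toENNReal_le.2 h1
  refine tendsto_order.2 ⟨fun a ha => ?_, fun a ha => ?_⟩
  · obtain ⟨n, hn, han⟩ : ∃ n : ℕ, (n : ℕ∞) ≤ S.encard ∧ a < n := by
      by_cases hS : S.encard = ⊤
      · obtain ⟨n, hn⟩ := ENNReal.exists_nat_gt (r := a) (by rintro rfl; simp at ha)
        exact ⟨n, by simp [hS], hn⟩
      · obtain ⟨n, hn⟩ := ENat.ne_top_iff_exists.1 hS
        exact ⟨n, hn.le, by simpa [← hn] using ha⟩
    exact (key n hn).mono fun k hk => han.trans_le hk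
  · exact Eventually.of_forall fun k =>
      (ENat.toENNReal_le.2 (encard_image_le _ _)).trans_lt ha

lemma encard_cellIndex_image_eq_tsum (k : ℕ) (S : Set ℝ) :
    (((cellIndex k '' S).encard : ℕ∞) : ℝ≥0∞)
      = ∑' j : ℤ, (cellIndex k '' S).indicator (fun _ => 1) j := by
  rw [← ENNReal.tsum_set_one, tsum_subtype (cellIndex k '' S) (fun _ => (1 : ℝ≥0∞))]

/-! ### Measurability of the zero count, and Fatou -/

/-- Projection along a compact factor is a closed map. -/
lemma isClosed_setOf_exists_zero {X : Type*} [TopologicalSpace X] {G : X → ℝ → ℝ}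
    (hG : Continuous (Function.uncurry G)) {K : Set ℝ} (hK : IsCompact K) :
    IsClosed {p | ∃ x ∈ K, G p x = 0} := by
  have : CompactSpace K := isCompact_iff_compactSpace.1 hK
  have hc : IsClosed {q : X × K | G q.1 q.2 = 0} :=
    isClosed_eq (hG.comp (by fun_prop : Continuous fun q : X × K => (q.1, (q.2 : ℝ))))
      continuous_const
  convert! isClosedMap_fst_of_compactSpace _ hc using 1
  ext p
  simp

lemma Ioc_eq_iUnion_Icc (a b : ℝ) : Ioc a b = ⋃ n : ℕ, Icc (a + 1 / ((n : ℝ) + 1)) b := by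
  ext x
  simp only [mem_Ioc, mem_iUnion, mem_Icc]
  constructor
  · rintro ⟨h1, h2⟩
    obtain ⟨n, hn⟩ := exists_nat_one_div_lt (sub_pos.2 h1)
    exact ⟨n, by linarith, h2⟩
  · rintro ⟨n, h1, h2⟩
    have : (0 : ℝ) < 1 / ((n : ℝ) + 1) := by positivity
    exact ⟨by linarith, h2⟩

/-- Cells are half-open to be disjoint, hence not compact; exhausting them by compact intervals
gives a countable union of closed sets. -/
lemma measurableSet_setOf_exists_zero {X : Type*} [TopologicalSpace X] [MeasurableSpace X]
    [OpensMeasurableSpace X] {G : X → ℝ → ℝ} (hG : Continuous (Function.uncurry G))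
    (x₀ x₁ a b : ℝ) : MeasurableSet {p | ∃ x ∈ Icc x₀ x₁ ∩ Ioc a b, G p x = 0} := by
  have : {p | ∃ x ∈ Icc x₀ x₁ ∩ Ioc a b, G p x = 0}
      = ⋃ n : ℕ, {p | ∃ x ∈ Icc x₀ x₁ ∩ Icc (a + 1 / ((n : ℝ) + 1)) b, G p x = 0} := by
    ext p
    rw [Ioc_eq_iUnion_Icc, inter_iUnion]
    simp only [mem_ofPred_eq, mem_iUnion]
    tauto
  rw [this]
  exact .iUnion fun n => (isClosed_setOf_exists_zero hG (isCompact_Icc.inter isCompact_Icc)).measurableSet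

/-- The number of cells of mesh `1 / (k + 1)` that contain a zero of `f` in `[x₀, x₁]`. -/
noncomputable def zeroCellCount (k : ℕ) (f : ℝ → ℝ) (x₀ x₁ : ℝ) : ℝ≥0∞ :=
  ((cellIndex k '' {x ∈ Icc x₀ x₁ | f x = 0}).encard : ℕ∞)

lemma tendsto_zeroCellCount (f : ℝ → ℝ) (x₀ x₁ : ℝ) :
    Tendsto (fun k => zeroCellCount k f x₀ x₁) atTop (𝓝 (zeroCount f x₀ x₁)) :=
  tendsto_encard_cellIndex_image _

lemma zeroCellCount_eq_tsum (k : ℕ) {X : Type*} (G : X → ℝ → ℝ) (x₀ x₁ : ℝ) (p : X) :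
    zeroCellCount k (G p) x₀ x₁ = ∑' j : ℤ,
      {p | ∃ x ∈ Icc x₀ x₁ ∩ Ioc (((j : ℝ) - 1) / (k + 1)) ((j : ℝ) / (k + 1)),
        G p x = 0}.indicator (fun _ => 1) p := by
  rw [zeroCellCount, encard_cellIndex_image_eq_tsum]
  refine tsum_congr fun j => ?_
  have : j ∈ cellIndex k '' {x ∈ Icc x₀ x₁ | G p x = 0} ↔
      p ∈ {p | ∃ x ∈ Icc x₀ x₁ ∩ Ioc (((j : ℝ) - 1) / (k + 1)) ((j : ℝ) / (k + 1)),
        G p x = 0} := by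
    simp only [mem_image, mem_ofPred_eq, cellIndex_eq_iff, mem_inter_iff]
    constructor
    · rintro ⟨x, ⟨h1, h2⟩, h3⟩
      exact ⟨x, ⟨h1, h3⟩, h2⟩
    · rintro ⟨x, ⟨h1, h3⟩, h2⟩
      exact ⟨x, ⟨h1, h2⟩, h3⟩
  classical
  simp only [indicator_apply, this]

section

variable {X : Type*} [TopologicalSpace X] [MeasurableSpace X] [OpensMeasurableSpace X]
  {G : X → ℝ → ℝ}

lemma measurable_zeroCellCount (hG : Continuous (Function.uncurry G)) (k : ℕ) (x₀ x₁ : ℝ) :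
    Measurable fun p => zeroCellCount k (G p) x₀ x₁ := by
  simp only [zeroCellCount_eq_tsum]
  exact Measurable.tsum fun j =>
    measurable_const.indicator (measurableSet_setOf_exists_zero hG _ _ _ _)

lemma measurable_zeroCount (hG : Continuous (Function.uncurry G)) (x₀ x₁ : ℝ) :
    Measurable fun p => zeroCount (G p) x₀ x₁ :=
  measurable_of_tendsto_metrizable (measurable_zeroCellCount hG · x₀ x₁)
    (tendsto_pi_nhds.2 fun p => tendsto_zeroCellCount (G p) x₀ x₁)

lemma lintegral_zeroCount_le (hG : Continuous (Function.uncurry G)) (x₀ x₁ : ℝ) (μ : Measure X)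
    {C : ℝ≥0∞} (hC : ∀ k : ℕ, ∑' j : ℤ,
      μ {p | ∃ x ∈ Icc x₀ x₁ ∩ Ioc (((j : ℝ) - 1) / (k + 1)) ((j : ℝ) / (k + 1)), G p x = 0} ≤ C) :
    ∫⁻ p, zeroCount (G p) x₀ x₁ ∂μ ≤ C := by
  have h1 : ∀ k : ℕ, ∫⁻ p, zeroCellCount k (G p) x₀ x₁ ∂μ ≤ C := by
    intro k
    refine le_trans (le_of_eq ?_) (hC k)
    simp only [zeroCellCount_eq_tsum]
    rw [lintegral_tsum fun j => (measurable_const.indicator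
      (measurableSet_setOf_exists_zero hG _ _ _ _)).aemeasurable]
    refine tsum_congr fun j => ?_
    exact lintegral_indicator_one (measurableSet_setOf_exists_zero hG _ _ _ _)
  calc ∫⁻ p, zeroCount (G p) x₀ x₁ ∂μ
      = ∫⁻ p, liminf (fun k => zeroCellCount k (G p) x₀ x₁) atTop ∂μ := by
        simp only [(tendsto_zeroCellCount _ x₀ x₁).liminf_eq]
    _ ≤ liminf (fun k => ∫⁻ p, zeroCellCount k (G p) x₀ x₁ ∂μ) atTop :=
        lintegral_liminf_le fun k => measurable_zeroCellCount hG k x₀ x₁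
    _ ≤ C := liminf_le_of_frequently_le' (Frequently.of_forall h1)

end

/-! ### The bound for a product law -/

/-- The increments of a continuous monotone function over the cells add up to at most its total
variation. -/
lemma tsum_increments_cells_le {f : ℝ → ℝ} (hf : Monotone f) (hc : Continuous f) {l r : ℝ}
    (hl : Tendsto f atBot (𝓝 l)) (hr : Tendsto f atTop (𝓝 r)) (k : ℕ) :
    ∑' j : ℤ, ENNReal.ofReal (f ((j : ℝ) / (k + 1)) - f (((j : ℝ) - 1) / (k + 1)))
      ≤ ENNReal.ofReal (r - l) := by
  -- Each increment is the Stieltjes measure of a cell, and the cells are disjoint.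
  let s : StieltjesFunction ℝ := ⟨f, hf, fun x => hc.continuousWithinAt⟩
  calc ∑' j : ℤ, ENNReal.ofReal (f ((j : ℝ) / (k + 1)) - f (((j : ℝ) - 1) / (k + 1)))
      = ∑' j : ℤ, s.measure (Ioc (((j : ℝ) - 1) / (k + 1)) ((j : ℝ) / (k + 1))) := by
        simp only [s.measure_Ioc]; rfl
    _ ≤ s.measure (⋃ j : ℤ, Ioc (((j : ℝ) - 1) / (k + 1)) ((j : ℝ) / (k + 1))) := by
        refine tsum_meas_le_meas_iUnion_of_disjoint _ (fun j => measurableSet_Ioc) ?_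
        intro i j hij
        refine disjoint_left.2 fun x hi hj => hij ?_
        rw [← (cellIndex_eq_iff k x i).2 hi, (cellIndex_eq_iff k x j).2 hj]
    _ ≤ s.measure univ := measure_mono (subset_univ _)
    _ = ENNReal.ofReal (r - l) := s.measure_univ hl hr

/-- Zeros at `x` and `y` for `t` and `t'` give `t - t' = ∑ (w i y - w i x) * c i`; volume is at most
diameter. -/
lemma volume_setOf_exists_add_eq_zero_le {n : ℕ} {w : Fin n → ℝ → ℝ} (hw : ∀ i, Monotone (w i))
    (c : Fin n → ℝ) (a b : ℝ) (s : Set ℝ) :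
    volume {t : ℝ | ∃ x ∈ s ∩ Ioc a b, t + ∑ i, w i x * c i = 0}
      ≤ ∑ i, ENNReal.ofReal (w i b - w i a) * ENNReal.ofReal |c i| := by
  refine (Real.volume_le_diam _).trans (Metric.ediam_le ?_)
  rintro t ⟨x, ⟨-, hx⟩, ht⟩ t' ⟨y, ⟨-, hy⟩, ht'⟩
  have hab : a ≤ b := hx.1.le.trans hx.2
  have h0 : ∀ i, 0 ≤ w i b - w i a := fun i => sub_nonneg.2 (hw i hab)
  have h1 : |t - t'| ≤ ∑ i, (w i b - w i a) * |c i| := by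
    have : t - t' = ∑ i, (w i y - w i x) * c i := by
      simp only [sub_mul, Finset.sum_sub_distrib]
      linarith
    rw [this]
    refine (Finset.abs_sum_le_sum_abs _ _).trans (Finset.sum_le_sum fun i _ => ?_)
    rw [abs_mul]
    refine mul_le_mul_of_nonneg_right ?_ (abs_nonneg _)
    rw [abs_le]
    constructor <;> linarith [hw i hx.1.le, hw i hx.2, hw i hy.1.le, hw i hy.2]
  rw [edist_dist, Real.dist_eq]
  refine (ENNReal.ofReal_le_ofReal h1).trans (le_of_eq ?_)
  rw [ENNReal.ofReal_sum_of_nonneg fun i _ => mul_nonneg (h0 i) (abs_nonneg _)]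
  simp only [ENNReal.ofReal_mul (h0 _)]

/-- Expected number of zeros of `t + ∑ wᵢ(x) cᵢ` when `t` and `c` are independent, the law of `t`
is at most `A` times Lebesgue measure and `E |cᵢ| ≤ B`. -/
lemma lintegral_zeroCount_prod_le {n : ℕ} {w : Fin n → ℝ → ℝ} (hw : ∀ i, Monotone (w i))
    (hc : ∀ i, Continuous (w i)) {l r : Fin n → ℝ} (hl : ∀ i, Tendsto (w i) atBot (𝓝 (l i)))
    (hr : ∀ i, Tendsto (w i) atTop (𝓝 (r i))) (x₀ x₁ : ℝ) (μ : Measure ℝ) [SFinite μ]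
    (ν : Measure (Fin n → ℝ)) [SFinite ν] {A B : ℝ≥0∞} (hμ : μ ≤ A • volume)
    (hν : ∀ i, ∫⁻ c, ENNReal.ofReal |c i| ∂ν ≤ B) :
    ∫⁻ p, zeroCount (fun x => p.1 + ∑ i, w i x * p.2 i) x₀ x₁ ∂(μ.prod ν)
      ≤ A * B * ∑ i, ENNReal.ofReal (r i - l i) := by
  let G : ℝ × (Fin n → ℝ) → ℝ → ℝ := fun p x => p.1 + ∑ i, w i x * p.2 i
  have hG : Continuous (Function.uncurry G) := by
    simp only [Function.uncurry_def, G]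
    fun_prop
  refine lintegral_zeroCount_le hG x₀ x₁ _ fun k => ?_
  have hcell : ∀ a b : ℝ, (μ.prod ν) {p | ∃ x ∈ Icc x₀ x₁ ∩ Ioc a b, G p x = 0}
      ≤ ∑ i, A * B * ENNReal.ofReal (w i b - w i a) := by
    intro a b
    rw [Measure.prod_apply_symm (measurableSet_setOf_exists_zero hG _ _ _ _)]
    calc _ ≤ ∫⁻ c, A * ∑ i, ENNReal.ofReal (w i b - w i a) * ENNReal.ofReal |c i| ∂ν := by
          refine lintegral_mono fun c => (hμ _).trans ?_
          rw [Measure.smul_apply, smul_eq_mul]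
          gcongr
          exact volume_setOf_exists_add_eq_zero_le hw c a b _
      _ = ∑ i, A * (ENNReal.ofReal (w i b - w i a) * ∫⁻ c, ENNReal.ofReal |c i| ∂ν) := by
          rw [lintegral_const_mul _ (by fun_prop), lintegral_finsetSum _ (by fun_prop),
            Finset.mul_sum]
          refine Finset.sum_congr rfl fun i _ => ?_
          rw [lintegral_const_mul _ (by fun_prop)]
      _ ≤ ∑ i, A * B * ENNReal.ofReal (w i b - w i a) := by
          refine Finset.sum_le_sum fun i _ => ?_
          rw [mul_assoc, mul_comm B]
          gcongr
          exact hν i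
  calc _ ≤ ∑' j : ℤ, ∑ i, A * B *
        ENNReal.ofReal (w i ((j : ℝ) / (k + 1)) - w i (((j : ℝ) - 1) / (k + 1))) :=
        ENNReal.tsum_le_tsum fun j => hcell _ _
    _ = ∑ i, A * B * ∑' j : ℤ,
        ENNReal.ofReal (w i ((j : ℝ) / (k + 1)) - w i (((j : ℝ) - 1) / (k + 1))) := by
        rw [Summable.tsum_finsetSum fun i _ => ENNReal.summable]
        simp only [ENNReal.tsum_mul_left]
    _ ≤ A * B * ∑ i, ENNReal.ofReal (r i - l i) := by
        rw [Finset.mul_sum]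
        refine Finset.sum_le_sum fun i _ => ?_
        gcongr
        exact tsum_increments_cells_le (hw i) (hc i) (hl i) (hr i) k

lemma zeroCount_congr {f g : ℝ → ℝ} {x₀ x₁ : ℝ} (h : EqOn f g (Icc x₀ x₁)) :
    zeroCount f x₀ x₁ = zeroCount g x₀ x₁ := by
  have : {x ∈ Icc x₀ x₁ | f x = 0} = {x ∈ Icc x₀ x₁ | g x = 0} := by
    ext x
    simp only [mem_ofPred_eq]
    exact and_congr_right fun hx => by rw [h hx]
  rw [zeroCount, zeroCount, this]

/-! ### Transfer to random variables -/

section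

variable {Ω : Type*} [MeasurableSpace Ω] {P : Measure Ω}

lemma HasRealDensity.map_le {X : Ω → ℝ} {φ : ℝ → ℝ} (h : HasRealDensity P X φ) {A : ℝ}
    (hA : ∀ᵐ t, φ t ≤ A) : P.map X ≤ ENNReal.ofReal A • volume := by
  rw [h.map_eq, ← withDensity_const]
  exact withDensity_mono (hA.mono fun t ht => ENNReal.ofReal_le_ofReal ht)

lemma HasRealDensity.lintegral_abs_le {X : Ω → ℝ} {φ : ℝ → ℝ} (h : HasRealDensity P X φ) {B : ℝ}
    (hi : Integrable fun t => |t| * φ t) (hB : ∫ t, |t| * φ t ≤ B) :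
    ∫⁻ t, ENNReal.ofReal |t| ∂(P.map X) ≤ ENNReal.ofReal B := by
  rw [h.map_eq, lintegral_withDensity_eq_lintegral_mul₀
    h.aemeasurable_density.ennreal_ofReal (by fun_prop)]
  refine le_trans (le_of_eq ?_) (ENNReal.ofReal_le_ofReal hB)
  rw [ofReal_integral_eq_lintegral_ofReal hi
    (Eventually.of_forall fun t => mul_nonneg (abs_nonneg t) (h.nonneg t))]
  refine lintegral_congr fun t => ?_
  rw [Pi.mul_apply, mul_comm, ENNReal.ofReal_mul (abs_nonneg t)]

/-- If `u` are independent random variables, the first one and the vector of the others have the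
product law, with marginals those of the `u i`. -/
lemma map_head_tail_eq_prod [IsProbabilityMeasure P] {n : ℕ} {u : Fin (n + 1) → Ω → ℝ}
    (hm : ∀ i, AEMeasurable (u i) P) (hindep : iIndepFun u P) :
    P.map (fun ω => (u 0 ω, fun i : Fin n => u i.succ ω))
      = (P.map (u 0)).prod (Measure.pi fun i : Fin n => P.map (u i.succ)) := by
  have (i : _) : IsProbabilityMeasure (P.map (u i)) := Measure.isProbabilityMeasure_map (hm i)
  have h1 := (iIndepFun_iff_map_fun_eq_pi_map hm).1 hindep
  have h2 := (measurePreserving_piFinSuccAbove (fun i => P.map (u i)) 0).map_eq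
  rw [← h1, AEMeasurable.map_map_of_aemeasurable (by fun_prop) (aemeasurable_pi_lambda _ hm)] at h2
  exact h2

theorem aemeasurable_zeroCount_and_lintegral_le [IsProbabilityMeasure P]
    {n : ℕ} {u : Fin (n + 1) → Ω → ℝ} {φ : Fin (n + 1) → ℝ → ℝ}
    (hu : ∀ i, HasRealDensity P (u i) (φ i)) (hindep : iIndepFun u P)
    {A B : ℝ} (hA : ∀ i, ∀ᵐ t, φ i t ≤ A)
    (hB : ∀ i, Integrable (fun t => |t| * φ i t) ∧ ∫ t, |t| * φ i t ≤ B)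
    {x₀ x₁ : ℝ} (hx : x₀ ≤ x₁) {w : Fin n → ℝ → ℝ} (hc : ∀ i, ContinuousOn (w i) (Icc x₀ x₁))
    (hw : ∀ i, MonotoneOn (w i) (Icc x₀ x₁)) :
    AEMeasurable
      (fun ω => zeroCount (fun x => u 0 ω + ∑ i : Fin n, w i x * u i.succ ω) x₀ x₁) P ∧
    ∫⁻ ω, zeroCount (fun x => u 0 ω + ∑ i : Fin n, w i x * u i.succ ω) x₀ x₁ ∂P
      ≤ ENNReal.ofReal (A * B * ∑ i : Fin n, (w i x₁ - w i x₀)) := by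
  have hm : ∀ i, AEMeasurable (u i) P := fun i => (hu i).aemeasurable
  have (i : _) : IsProbabilityMeasure (P.map (u i)) := Measure.isProbabilityMeasure_map (hm i)
  have hA0 : 0 ≤ A := by
    obtain ⟨t, ht⟩ := (hA 0).exists
    exact ((hu 0).nonneg t).trans ht
  have hB0 : 0 ≤ B :=
    (integral_nonneg fun t => mul_nonneg (abs_nonneg t) ((hu 0).nonneg t)).trans (hB 0).2
  -- Cells may stick out of the interval, so `w i` is extended by constants; its limits at `±∞` are
  -- then its endpoint values.
  let v : Fin n → ℝ → ℝ := fun i => IccExtend hx ((Icc x₀ x₁).domRestrict (w i))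
  have hvw : ∀ i, EqOn (v i) (w i) (Icc x₀ x₁) := fun i x hx' => IccExtend_of_mem hx _ hx'
  have hvm : ∀ i, Monotone (v i) := fun i =>
    Monotone.IccExtend hx fun a b hab => hw i a.2 b.2 hab
  have hvc : ∀ i, Continuous (v i) := fun i => (hc i).domRestrict.Icc_extend'
  have hbot : ∀ i, Tendsto (v i) atBot (𝓝 (w i x₀)) := fun i =>
    tendsto_const_nhds.congr' <| (eventually_le_atBot x₀).mono fun x hx' =>
      (IccExtend_of_le_left hx _ hx').symm
  have htop : ∀ i, Tendsto (v i) atTop (𝓝 (w i x₁)) := fun i =>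
    tendsto_const_nhds.congr' <| (eventually_ge_atTop x₁).mono fun x hx' =>
      (IccExtend_of_right_le hx _ hx').symm
  let Z : ℝ × (Fin n → ℝ) → ℝ≥0∞ := fun p => zeroCount (fun x => p.1 + ∑ i, v i x * p.2 i) x₀ x₁
  have hZ : Measurable Z := by
    refine measurable_zeroCount (G := fun (p : ℝ × (Fin n → ℝ)) x => p.1 + ∑ i, v i x * p.2 i) ?_ x₀ x₁
    simp only [Function.uncurry_def]
    fun_prop
  have hpair : AEMeasurable (fun ω => (u 0 ω, fun i : Fin n => u i.succ ω)) P :=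
    (hm 0).prodMk (aemeasurable_pi_lambda _ fun i => hm i.succ)
  have hcount : (fun ω => zeroCount (fun x => u 0 ω + ∑ i : Fin n, w i x * u i.succ ω) x₀ x₁)
      = fun ω => Z (u 0 ω, fun i : Fin n => u i.succ ω) := by
    funext ω
    refine zeroCount_congr fun x hx' => ?_
    simp only [hvw _ hx']
  rw [hcount]
  refine ⟨hZ.comp_aemeasurable hpair, ?_⟩
  rw [← lintegral_map' hZ.aemeasurable hpair, map_head_tail_eq_prod hm hindep]
  refine (lintegral_zeroCount_prod_le hvm hvc hbot htop x₀ x₁ _ _ ((hu 0).map_le (hA 0))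
    (B := ENNReal.ofReal B) fun i => ?_).trans (le_of_eq ?_)
  · have := (measurePreserving_eval (fun i : Fin n => P.map (u i.succ)) i).lintegral_comp
      (f := fun t : ℝ => ENNReal.ofReal |t|) (by fun_prop)
    exact this.trans_le ((hu i.succ).lintegral_abs_le (hB i.succ).1 (hB i.succ).2)
  · have h0 : ∀ i, 0 ≤ w i x₁ - w i x₀ := fun i =>
      sub_nonneg.2 (hw i (left_mem_Icc.2 hx) (right_mem_Icc.2 hx) hx)
    rw [ENNReal.ofReal_mul (mul_nonneg hA0 hB0), ENNReal.ofReal_mul hA0,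
      ENNReal.ofReal_sum_of_nonneg fun i _ => h0 i]

end

theorem corollary4p4 {Ω : Type*} [MeasurableSpace Ω] (P : Measure Ω) [IsProbabilityMeasure P]
    (n : ℕ) (u : Fin (n + 1) → Ω → ℝ) (φ : Fin (n + 1) → ℝ → ℝ)
    (hu : ∀ i, HasRealDensity P (u i) (φ i)) (hindep : iIndepFun u P)
    (A B : ℝ) (hA : ∀ i, ∀ᵐ t, φ i t ≤ A)
    (hB : ∀ i, Integrable (fun t => |t| * φ i t) ∧ ∫ t, |t| * φ i t ≤ B) :
    (∀ (x₀ x₁ : ℝ), x₀ ≤ x₁ → ∀ w : Fin n → ℝ → ℝ,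
      (∀ i, AnalyticOn ℝ (w i) (Icc x₀ x₁)) →
      (∀ i, MonotoneOn (w i) (Icc x₀ x₁)) →
        AEMeasurable
          (fun ω => zeroCount (fun x => u 0 ω + ∑ i : Fin n, w i x * u i.succ ω) x₀ x₁) P ∧
        ∫⁻ ω, zeroCount (fun x => u 0 ω + ∑ i : Fin n, w i x * u i.succ ω) x₀ x₁ ∂P
          ≤ ENNReal.ofReal (A * B * ∑ i : Fin n, (w i x₁ - w i x₀))) ∧
    (∀ d : Fin (n + 1) → ℕ, d 0 = 0 → StrictMono d →
        AEMeasurable (fun ω => zeroCount (fun x => ∑ i, u i ω * x ^ d i) 0 1) P ∧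
        ∫⁻ ω, zeroCount (fun x => ∑ i, u i ω * x ^ d i) 0 1 ∂P
          ≤ ENNReal.ofReal (A * B * n)) := by
  refine ⟨fun x₀ x₁ hx w hw hmono => aemeasurable_zeroCount_and_lintegral_le hu hindep hA hB hx
    (fun i => (hw i).continuousOn) hmono, fun d hd0 hd => ?_⟩
  have hpos : ∀ i : Fin n, d i.succ ≠ 0 := fun i => by
    have := hd (Fin.succ_pos i)
    omega
  -- Each `x ^ d i.succ` increases by exactly 1 on `[0, 1]`, the exponent being nonzero.
  have h := aemeasurable_zeroCount_and_lintegral_le hu hindep hA hB zero_le_one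
    (w := fun i x => x ^ d i.succ) (fun i => (continuous_pow _).continuousOn)
    (fun i x hx y _ hxy => pow_le_pow_left₀ hx.1 hxy _)
  simpa [Fin.sum_univ_succ, hd0, hpos, mul_comm] using h
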